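/- **Setting.** Fix integers $b\ge 2$, $d$, $L$. For $0\le k\le L$ let $V_k=\mathbb{R}^{b^k\times\cdots\times b^k}$ be the space of tensors of order $d$ with the Frobenius norm. For $k\le m$, $\mathrm{ext}_{m-k}:V_k\to V_m$ replaces every entry by a constant block with side lengths $b^{m-k}$, and $\mathrm{ave}_{m-k}:V_m\to V_k$ takes the average over each such block. A tensor format $\mathcal F$ specifies on every grid a set of tensors and a rank (a number, or a vector compared entrywise); $\mathcal F_r$ denotes the tensors of the format of rank at most $r$. $\mathrm{round}_{\mathcal F_r}(Y)$ denotes any best approximation of $Y$ in $\mathcal F_r$. Given ranks $r_0,\dots,r_L$, the multiresolution format is the set of all $\sum_{k=0}^L\mathrm{ext}_{L-k}(X_k)$ with $X_k\in V_k\cap\mathcal F_{r_k}$. Write $\rho_k=r_{k+1}+\dots+r_L$. **Algorithm.** Let $T\in V_L$ and let $M$ be the maximum number of iterations. For $k=0,1,\dots,L$ in turn, start from $T_k^{(0)}\in V_k$ and $S_k^{(0)}\in V_L$, and for $n=0,\dots,M-1$ set $$T_k^{(n+1)}=\mathrm{round}_{\mathcal F_{r_k}}\Bigl(\mathrm{ave}_{L-k}\bigl(T-\sum_{\ell<k}\mathrm{ext}_{L-\ell}(T_\ell^{(M)})-S_k^{(n)}\bigr)\Bigr),$$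 $$S_k^{(n+1)}=\mathrm{round}_{\mathcal F_{\rho_k}}\Bigl(T-\sum_{\ell<k}\mathrm{ext}_{L-\ell}(T_\ell^{(M)})-\mathrm{ext}_{L-k}(T_k^{(n+1)})\Bigr).$$ **Assumptions.** Let $T_k\in V_k\cap\mathcal F_{r_k}$ $(0\le k\le L)$ and put $U_k=\sum_{\ell>k}\mathrm{ext}_{L-\ell}(T_\ell)$, $R=T-\sum_{k=0}^L\mathrm{ext}_{L-k}(T_k)$. 1. For every $k$, the sets $\mathcal F_{r_k}\subset V_k$ and $\mathcal F_{\rho_k}\subset V_L$ are (weakly) closed, and they are smooth embedded submanifolds in a neighbourhood of $T_k$ and of $U_k$, respectively. 2. For every $k$, the tensor $U_k$ has rank exactly $\rho_k$. 3. $\theta>0$ is such that, for every $M$, all $0\le n<M$ and all $k$, the errors $$E_k^{(n)}=\mathrm{ave}_{L-k}\Bigl(R-S_k^{(n)}+U_k+\sum_{\ell<k}\mathrm{ext}_{L-\ell}(T_\ell-T_\ell^{(M)})\Bigr),\qquad D_k^{(n)}=R+\mathrm{ext}_{L-k}(T_k-T_k^{(n+1)})+\sum_{\ell<k}\mathrm{ext}_{L-\ell}(T_\ell-T_\ell^{(M)})$$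 make angles greater than $\theta$ with the tangent space of $\mathcal F_{r_k}$ at $T_k$ and of $\mathcal F_{\rho_k}$ at $U_k$, respectively. (The angle is $\pi/2$ if the orthogonal projection to the tangent space vanishes, in particular for a zero error.) **Theorem.** Let assumptions 1 and 2 hold for $T_0,\dots,T_L$, and let $\theta>0$. There are a constant $C>0$ and real constants $C_0,\dots,C_L$, depending only on the format, the ranks, $T_0,\dots,T_L$ and $\theta$, such that the following holds for every $T\in V_L$ for which $\sum_{k}\mathrm{ext}_{L-k}(T_k)$ is an isolated, globally optimal approximation in the multiresolution format (isolated: no tensors $X_k\in\mathcal F_{r_k}$ sufficiently close to the $T_k$ give a globally optimal approximation different from $\sum_k\mathrm{ext}_{L-k}(T_k)$). Let the algorithm be run for every $M$ from an initial guess $T_0^{(0)},\dots,T_L^{(0)}$ with $\|T_k-T_k^{(0)}\|\le C$ for all $k$, where $S_k^{(0)}=\sum_{\ell>k}\mathrm{ext}_{L-\ell}(T_\ell^{(0)})$ or, more generally, $\|S_k^{(0)}-\sum_{\ell>k}\mathrm{ext}_{L-\ell}(T_\ell^{(0)})\|\le C$, and let assumption 3 hold. 1. If $T=\sum_{k}\mathrm{ext}_{L-k}(T_k)$,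 then $T_k^{(n)}\to T_k$ linearly for all $k$: there are $K$ and $q\in[0,1)$ with $\|T_k^{(n)}-T_k\|\le Kq^n$ for all $k$, all $M$ and all $0\le n\le M$. 2. More generally, suppose that $\|R\|\le C$. If $R\neq 0$, then there is $N$ such that for all $k$ and all $N\le n\le M$ $$\|T_k-T_k^{(n)}\|\le C_k\,\bigl\|T-\sum_{j=0}^L\mathrm{ext}_{L-j}(T_j)\bigr\| .$$ Moreover (also if $R=0$), the final iterates $T_k^{(M)}$ of the runs with maximum iteration numbers $M=0,1,2,\dots$ have a subsequence $M_1<M_2<\cdots$, the same for all $k$, with $T_k^{(M_j)}\to Y_k$ for all $k$ and $\|T_k-Y_k\|\le C_k\,\|T-\sum_{j=0}^L\mathrm{ext}_{L-j}(T_j)\|$. -/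

import Mathlib

open Filter Topology
open scoped ContDiff

namespace MultiRes

noncomputable section

/-! ### Grids, block extension and block averaging -/

/-- Real tensors of order `d` with all side lengths `b ^ k` (indices start at `0`),
with the Frobenius inner product and norm. -/
abbrev Tensor (b d k : ℕ) : Type := EuclideanSpace ℝ (Fin d → Fin (b ^ k))

theorem coarse_lt {b k m : ℕ} (h : k ≤ m) (i : Fin (b ^ m)) :
    (i : ℕ) / b ^ (m - k) < b ^ k := by
  apply Nat.div_lt_of_lt_mul
  rw [← pow_add, Nat.sub_add_cancel h]
  exact i.isLt

theorem fine_lt {b k m : ℕ} (h : k ≤ m) (i : Fin (b ^ k)) (j : Fin (b ^ (m - k))) :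
    (i : ℕ) * b ^ (m - k) + j < b ^ m := by
  have h1 : ((i : ℕ) + 1) * b ^ (m - k) ≤ b ^ k * b ^ (m - k) :=
    Nat.mul_le_mul_right _ i.isLt
  rw [← pow_add, Nat.add_sub_cancel' h] at h1
  have h2 := j.isLt
  rw [Nat.add_mul, one_mul] at h1
  omega

/-- `ext_{m-k}`: every entry is replaced by a block of side length `b ^ (m - k)`. -/
def ext {b d k m : ℕ} (h : k ≤ m) (X : Tensor b d k) : Tensor b d m :=
  WithLp.toLp 2 fun i => X fun a => ⟨(i a : ℕ) / b ^ (m - k), coarse_lt h (i a)⟩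

/-- `ave_{m-k}`: the average over each block of side length `b ^ (m - k)`. -/
def ave {b d k m : ℕ} (h : k ≤ m) (Y : Tensor b d m) : Tensor b d k :=
  WithLp.toLp 2 fun i => (1 / (b : ℝ) ^ ((m - k) * d)) *
    ∑ j : Fin d → Fin (b ^ (m - k)),
      Y fun a => ⟨(i a : ℕ) * b ^ (m - k) + (j a : ℕ), fine_lt h (i a) (j a)⟩

/-- One tensor for every scale `0, …, L`. -/
abbrev Scales (b d L : ℕ) : Type := (k : Fin (L + 1)) → Tensor b d k

variable {b d L : ℕ}

/-- `∑_{ℓ = 0}^{L} ext_{L-ℓ} (X_ℓ)`. -/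
def total (X : Scales b d L) : Tensor b d L := ∑ l, ext (Fin.is_le l) (X l)

/-- `∑_{ℓ > k} ext_{L-ℓ} (X_ℓ)`. -/
def finer (X : Scales b d L) (k : Fin (L + 1)) : Tensor b d L :=
  ∑ l ∈ Finset.Ioi k, ext (Fin.is_le l) (X l)

/-- `∑_{ℓ < k} ext_{L-ℓ} (X_ℓ)`. -/
def coarser (X : Scales b d L) (k : Fin (L + 1)) : Tensor b d L :=
  ∑ l ∈ Finset.Iio k, ext (Fin.is_le l) (X l)

/-! ### Tensor formats -/

/-- A tensor format: on every grid, the set of tensors that it represents, and a rank, which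
may be a number or a vector of numbers (compared entrywise). -/
structure TensorFormat (b d : ℕ) (P : Type*) where
  carrier : (k : ℕ) → Set (Tensor b d k)
  rank : (k : ℕ) → Tensor b d k → P

/-- `F_r` on the grid with side length `b ^ k`: the tensors of rank no greater than `r`. -/
def TensorFormat.le {P : Type*} [PartialOrder P] (F : TensorFormat b d P) (k : ℕ) (r : P) :
    Set (Tensor b d k) :=
  {X | X ∈ F.carrier k ∧ F.rank k X ≤ r}

/-- `r_{k+1} + ⋯ + r_L`. -/
def finerRank {P : Type*} [AddCommMonoid P] (r : Fin (L + 1) → P) (k : Fin (L + 1)) : P :=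
  ∑ l ∈ Finset.Ioi k, r l

/-- The multiresolution format with rank vector `r = (r_0, …, r_L)`. -/
def multiresolution {P : Type*} [PartialOrder P] (F : TensorFormat b d P)
    (r : Fin (L + 1) → P) : Set (Tensor b d L) :=
  {Y | ∃ X : Scales b d L, (∀ k : Fin (L + 1), X k ∈ F.le k (r k)) ∧ Y = total X}

/-- `p` is a best approximation of `y` in `S`, that is, a possible value of `round_S (y)`. -/
def IsRound {E : Type*} [NormedAddCommGroup E] (S : Set E) (y p : E) : Prop :=
  p ∈ S ∧ ∀ q ∈ S, ‖y - p‖ ≤ ‖y - q‖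

/-- `∑ ext_{L-k} (T_k)`, with `T_k` in `F_{r_k}`, is a globally optimal approximation of `A` in
the multiresolution format, and it is isolated: no tensors `X_k` in `F_{r_k}` close to
the `T_k` give a different globally optimal approximation. -/
def IsIsolatedOptimal {P : Type*} [PartialOrder P] (F : TensorFormat b d P)
    (r : Fin (L + 1) → P) (A : Tensor b d L) (T : Scales b d L) : Prop :=
  (∀ k : Fin (L + 1), T k ∈ F.le k (r k)) ∧
  IsRound (multiresolution F r) A (total T) ∧
  ∃ ε > 0, ∀ X : Scales b d L, (∀ k : Fin (L + 1), X k ∈ F.le k (r k)) → (∀ k, ‖X k - T k‖ < ε) →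
    IsRound (multiresolution F r) A (total X) → total X = total T

/-! ### Embedded manifolds, tangent spaces, angles -/

section Geometry

variable {E : Type*} [NormedAddCommGroup E] [InnerProductSpace ℝ E]

/-- Near its point `x`, the set `S` is a smooth embedded submanifold: a diffeomorphism
between open sets, the first containing `x`, maps `S` onto a linear subspace. -/
def IsSmoothEmbeddedAt (S : Set E) (x : E) : Prop :=
  x ∈ S ∧ ∃ (Φ : OpenPartialHomeomorph E E) (W : Submodule ℝ E),
    x ∈ Φ.source ∧ ContDiffOn ℝ ∞ Φ Φ.source ∧ ContDiffOn ℝ ∞ Φ.symm Φ.target ∧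
      ∀ y ∈ Φ.source, y ∈ S ↔ Φ y ∈ W

/-- The tangent space of `S` at `x`: (the span of) the velocities of the smooth curves in `S`
through `x`. Where `S` is an embedded submanifold the velocities already form a subspace. -/
def tangentSpaceAt (S : Set E) (x : E) : Submodule ℝ E :=
  Submodule.span ℝ {v | ∃ γ : ℝ → E, ContDiffAt ℝ ∞ γ 0 ∧ γ 0 = x ∧
    (∀ᶠ t in 𝓝 (0 : ℝ), γ t ∈ S) ∧ HasDerivAt γ v 0}

/-- The angle between a vector and a subspace: the angle between the vector and its orthogonal
projection. It is `π / 2` if the projection is zero, and in particular for the zero vector. -/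
def angleTo [FiniteDimensional ℝ E] (v : E) (V : Submodule ℝ E) : ℝ :=
  InnerProductGeometry.angle v (V.starProjection v)

end Geometry

/-! ### The restructured alternating algorithm -/

/-- A run of the algorithm on `A` with maximum iteration number `M`. On scale `k`, the iterates
are `X k n` on the grid of scale `k` and `S k n` on the finest grid, for `n = 0, …, M`.
The scales are processed in increasing order, and scale `k` uses the final iterates `X l M` of
the coarser scales `l < k`. On the finest scale `k = L` the rank of the `S k n` is `0`. -/
def IsRun {P : Type*} [AddCommMonoid P] [PartialOrder P] (F : TensorFormat b d P)
    (r : Fin (L + 1) → P) (A : Tensor b d L) (M : ℕ)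
    (X : (k : Fin (L + 1)) → ℕ → Tensor b d k) (S : Fin (L + 1) → ℕ → Tensor b d L) : Prop :=
  ∀ k : Fin (L + 1), ∀ n < M,
    IsRound (F.le k (r k))
      (ave (Fin.is_le k) (A - coarser (fun l => X l M) k - S k n)) (X k (n + 1)) ∧
    IsRound (F.le L (finerRank r k))
      (A - coarser (fun l => X l M) k - ext (Fin.is_le k) (X k (n + 1))) (S k (n + 1))

/-- The amalgamated error `E_k^{(n)}`, where `R = A - ∑ ext_{L-k} (T_k)`. -/
def errorE (A : Tensor b d L) (T : Scales b d L) (M : ℕ)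
    (X : (k : Fin (L + 1)) → ℕ → Tensor b d k) (S : Fin (L + 1) → ℕ → Tensor b d L)
    (k : Fin (L + 1)) (n : ℕ) : Tensor b d k :=
  ave (Fin.is_le k)
    ((A - total T) - S k n + finer T k + coarser (fun l => T l - X l M) k)

/-- The amalgamated error `D_k^{(n)}`, where `R = A - ∑ ext_{L-k} (T_k)`. -/
def errorD (A : Tensor b d L) (T : Scales b d L) (M : ℕ)
    (X : (k : Fin (L + 1)) → ℕ → Tensor b d k) (k : Fin (L + 1)) (n : ℕ) : Tensor b d L :=
  (A - total T) + ext (Fin.is_le k) (T k - X k (n + 1)) + coarser (fun l => T l - X l M) k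

/-- Existence of approximations: the sets `F_{r_k}` and `F_{r_{k+1} + ⋯ + r_L}` are closed
(for finite-dimensional spaces this is weak closedness), and smooth embedded manifolds
around `T_k` and around `∑_{ℓ > k} ext_{L-ℓ} (T_ℓ)`, respectively. -/
def ClosedSmooth {P : Type*} [AddCommMonoid P] [PartialOrder P] (F : TensorFormat b d P)
    (r : Fin (L + 1) → P) (T : Scales b d L) : Prop :=
  ∀ k : Fin (L + 1),
    (IsClosed (F.le k (r k)) ∧ IsSmoothEmbeddedAt (F.le k (r k)) (T k)) ∧
    (IsClosed (F.le L (finerRank r k)) ∧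
      IsSmoothEmbeddedAt (F.le L (finerRank r k)) (finer T k))

/-- Minimality: `∑_{ℓ > k} ext_{L-ℓ} (T_ℓ)` has rank `r_{k+1} + ⋯ + r_L`. -/
def Minimal {P : Type*} [AddCommMonoid P] (F : TensorFormat b d P)
    (r : Fin (L + 1) → P) (T : Scales b d L) : Prop :=
  ∀ k : Fin (L + 1), finer T k ∈ F.carrier L ∧ F.rank L (finer T k) = finerRank r k

/-- Angle condition for a run with maximum iteration number `M`: the amalgamated errors subtend
angles greater than `θ` to the tangent spaces of `F_{r_k}` at `T_k` and of
`F_{r_{k+1} + ⋯ + r_L}` at `∑_{ℓ > k} ext_{L-ℓ} (T_ℓ)`. -/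
def AngleSeparated {P : Type*} [AddCommMonoid P] [PartialOrder P] (F : TensorFormat b d P)
    (r : Fin (L + 1) → P) (A : Tensor b d L) (T : Scales b d L) (θ : ℝ) (M : ℕ)
    (X : (k : Fin (L + 1)) → ℕ → Tensor b d k) (S : Fin (L + 1) → ℕ → Tensor b d L) : Prop :=
  ∀ k : Fin (L + 1), ∀ n < M,
    θ < angleTo (errorE A T M X S k n) (tangentSpaceAt (F.le k (r k)) (T k)) ∧
    θ < angleTo (errorD A T M X k n)
      (tangentSpaceAt (F.le L (finerRank r k)) (finer T k))

end

end MultiRes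

namespace MultiRes

/-! ### Best approximation near a point of an embedded submanifold. -/

section Geometry

variable {E : Type*} [NormedAddCommGroup E] [InnerProductSpace ℝ E]

/-! Since averaging is a left inverse of extension, the two roundings on scale `k` are best
approximations of `T_k + E_k` and `U_k + D_k`. Near a point `x` of an embedded submanifold, rounding
`x + e` moves `x` by the tangential part of `e` up to `o(‖e‖)` (`norm_round_sub_le`). The angle
condition makes the tangential part at most `max 0 (cos θ) * ‖e‖`, so small errors contract by a
factor `rate θ < 1` (`round_contracts`).

On the finest grid, `E_k` is bounded by the current error of `S` plus `g`, and `D_k` by that of `X`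
plus `g`, where `g` collects the residual and the final errors of the coarser scales. The
alternation therefore yields a geometric term plus `g / (1 - rate θ)` (`alternating_bound`,
`scale_bound`). Induction over the scales turns this into the bound `K * rate θ ^ n + B * ‖R‖` for
all iterates (`exists_iterate_bound`). The smallness of `C` keeps all errors in the region of
contraction. The claims follow from this bound, with compactness for the subsequence. -/

theorem norm_starProjection_le_of_lt_angleTo [FiniteDimensional ℝ E] {θ : ℝ} (hθ : 0 < θ) {v : E}
    {V : Submodule ℝ E} (h : θ < angleTo v V) :
    ‖V.starProjection v‖ ≤ max 0 (Real.cos (min θ Real.pi)) * ‖v‖ := by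
  by_cases h0 : V.starProjection v = 0
  · rw [h0, norm_zero]; positivity
  have hin : inner ℝ v (V.starProjection v) = ‖V.starProjection v‖ ^ 2 := by
    have h1 := V.starProjection_inner_eq_zero v _ (V.starProjection_apply_mem v)
    rw [inner_sub_left, real_inner_self_eq_norm_sq] at h1
    linarith
  have hpos : 0 < ‖V.starProjection v‖ := norm_pos_iff.mpr h0
  have hcos := InnerProductGeometry.cos_angle_mul_norm_mul_norm v (V.starProjection v)
  rw [hin] at hcos
  have h2 : Real.cos (InnerProductGeometry.angle v (V.starProjection v)) * ‖v‖
      = ‖V.starProjection v‖ := by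
    apply mul_right_cancel₀ hpos.ne'
    rw [mul_assoc, hcos, sq]
  rw [← h2]
  refine mul_le_mul_of_nonneg_right (le_max_of_le_right ?_) (norm_nonneg v)
  exact Real.cos_le_cos_of_nonneg_of_le_pi (le_min hθ.le Real.pi_pos.le)
    (InnerProductGeometry.angle_le_pi _ _) ((min_le_left _ _).trans h.le)

/-- The truncation at `π` matters because `cos` decreases only on `[0, π]` and returns to `1` for
larger `θ`. -/
theorem max_zero_cos_min_lt_one {θ : ℝ} (hθ : 0 < θ) :
    max 0 (Real.cos (min θ Real.pi)) < 1 := by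
  refine max_lt one_pos ?_
  rw [← Real.cos_zero]
  exact Real.cos_lt_cos_of_nonneg_of_le_pi le_rfl (min_le_right _ _) (lt_min hθ Real.pi_pos)

/-- Near an embedded point, `S` and its affine tangent space agree to first order. -/
theorem IsSmoothEmbeddedAt.tangent_approx [FiniteDimensional ℝ E] {S : Set E} {x : E}
    (hS : IsSmoothEmbeddedAt S x) {ε : ℝ} (hε : 0 < ε) :
    ∃ δ > 0, (∀ h : E, ‖h‖ ≤ δ → x + h ∈ S → ∃ t ∈ tangentSpaceAt S x, ‖h - t‖ ≤ ε * ‖h‖) ∧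
      ∀ t ∈ tangentSpaceAt S x, ‖t‖ ≤ δ → ∃ y ∈ S, ‖y - (x + t)‖ ≤ ε * ‖t‖ := by
  obtain ⟨hx, Φ, W, hxs, hΦ, hΨ, hW⟩ := hS
  have hyt : Φ x ∈ Φ.target := Φ.map_source hxs
  have dΦ : HasFDerivAt Φ (fderiv ℝ Φ x) x :=
    ((hΦ.contDiffAt (Φ.open_source.mem_nhds hxs)).differentiableAt (by simp)).hasFDerivAt
  have cΨ : ContDiffAt ℝ ∞ Φ.symm (Φ x) := hΨ.contDiffAt (Φ.open_target.mem_nhds hyt)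
  have dΨ : HasFDerivAt Φ.symm (fderiv ℝ Φ.symm (Φ x)) (Φ x) :=
    (cΨ.differentiableAt (by simp)).hasFDerivAt
  set A := fderiv ℝ Φ x
  set B := fderiv ℝ Φ.symm (Φ x)
  -- `A` and `B` are the derivatives of the chart and of its inverse; `B` maps `W` into the tangent
  -- space and `A` maps the tangent space into `W`.
  have hBA : ∀ v, B (A v) = v := by
    have h1 : HasFDerivAt (Φ.symm ∘ Φ) (B.comp A) x := dΨ.comp x dΦ
    have h2 : HasFDerivAt (Φ.symm ∘ Φ) (ContinuousLinearMap.id ℝ E) x := by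
      refine (hasFDerivAt_id x).congr_of_eventuallyEq ?_
      filter_upwards [Φ.open_source.mem_nhds hxs] with y hy
      simp [Φ.left_inv hy]
    intro v
    have := h1.unique h2
    exact congrArg (fun f : E →L[ℝ] E => f v) this
  have hxW : Φ x ∈ W := (hW x hxs).1 hx
  have symm_mem : ∀ w ∈ W, Φ x + w ∈ Φ.target → Φ.symm (Φ x + w) ∈ S := by
    intro w hw ht
    rw [hW _ (Φ.map_target ht), Φ.right_inv ht]
    exact W.add_mem hxW hw
  have hB_mem : ∀ w ∈ W, B w ∈ tangentSpaceAt S x := by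
    intro w hw
    refine Submodule.subset_span ⟨fun t => Φ.symm (Φ x + t • w), ?_, ?_, ?_, ?_⟩
    · refine ContDiffAt.comp (0 : ℝ) (g := Φ.symm) (f := fun t : ℝ => Φ x + t • w) ?_ ?_
      · simpa using cΨ
      · exact contDiffAt_const.add (contDiffAt_id.smul contDiffAt_const)
    · simp [Φ.left_inv hxs]
    · have hc : ContinuousAt (fun t : ℝ => Φ x + t • w) 0 := by fun_prop
      have := hc.preimage_mem_nhds (t := Φ.target)
        (by simpa using Φ.open_target.mem_nhds hyt)
      filter_upwards [this] with t ht
      exact symm_mem _ (W.smul_mem t hw) ht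
    · have h1 : HasDerivAt (fun t : ℝ => Φ x + t • w) w 0 := by
        simpa using ((hasDerivAt_id (0 : ℝ)).smul_const w).const_add (Φ x)
      have h2 : HasFDerivAt Φ.symm B (Φ x + (0 : ℝ) • w) := by simpa using dΨ
      exact h2.comp_hasDerivAt (0 : ℝ) h1
  -- In the chart, the difference quotients of a curve in `S` lie in `W`, which is closed, so the
  -- velocity lies in `W` too.
  have hA_mem : ∀ t ∈ tangentSpaceAt S x, A t ∈ W := by
    intro t ht
    have : tangentSpaceAt S x ≤ W.comap (A : E →ₗ[ℝ] E) := by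
      refine Submodule.span_le.2 ?_
      rintro v ⟨γ, hγ, hγ0, hγS, hγv⟩
      have h1 : HasDerivAt (Φ ∘ γ) (A v) 0 := by
        have h2 : HasFDerivAt Φ A (γ 0) := by rw [hγ0]; exact dΦ
        exact h2.comp_hasDerivAt (0 : ℝ) hγv
      have h3 := hasDerivAt_iff_tendsto_slope.1 h1
      refine W.closed_of_finiteDimensional.mem_of_tendsto h3 ?_
      have h4 : ∀ᶠ s in 𝓝 (0 : ℝ), γ s ∈ Φ.source :=
        hγv.continuousAt.preimage_mem_nhds (by rw [hγ0]; exact Φ.open_source.mem_nhds hxs)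
      filter_upwards [nhdsWithin_le_nhds h4, nhdsWithin_le_nhds hγS] with s hs hsS
      rw [slope_def_module]
      refine W.smul_mem _ (W.sub_mem ((hW _ hs).1 hsS) ?_)
      simpa [hγ0] using hxW
    exact this ht
  -- first-order expansions
  have hLip := dΦ.isBigO_sub
  obtain ⟨K, hK0, hK⟩ := hLip.exists_pos
  rw [Asymptotics.isBigOWith_iff] at hK
  -- The expansion of `Φ.symm` is applied to increments of size at most `K * ‖h‖` and `(‖A‖ + 1) *
  -- ‖t‖`; `ε` is divided by these factors. The `+ 1` covers `A = 0`.
  have hε1 : 0 < ε / K := by positivity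
  have hε2 : 0 < ε / (‖A‖ + 1) := by positivity
  have hc1 := (dΨ.isLittleO.def hε1)
  have hc2 := (dΨ.isLittleO.def hε2)
  have hcont : Tendsto Φ (𝓝 x) (𝓝 (Φ x)) := dΦ.continuousAt
  have e1 := (hK.and (hcont.eventually hc1)).and (Φ.open_source.mem_nhds hxs)
  have e2 := hc2.and (Φ.open_target.mem_nhds hyt)
  obtain ⟨δ₁, hδ₁, H1⟩ := Metric.eventually_nhds_iff.1 e1
  obtain ⟨δ₂, hδ₂, H2⟩ := Metric.eventually_nhds_iff.1 e2
  refine ⟨min (δ₁ / 2) (δ₂ / (2 * (‖A‖ + 1))), by positivity, ?_, ?_⟩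
  · intro h hh hhS
    have hd : dist (x + h) x < δ₁ := by
      rw [dist_eq_norm, add_sub_cancel_left]
      linarith [hh.trans (min_le_left _ _)]
    obtain ⟨⟨h1, h2⟩, h3⟩ := H1 hd
    refine ⟨B (Φ (x + h) - Φ x), hB_mem _ (W.sub_mem ((hW _ h3).1 hhS) hxW), ?_⟩
    rw [Φ.left_inv h3, Φ.left_inv hxs, add_sub_cancel_left] at h2
    rw [add_sub_cancel_left] at h1
    refine h2.trans ?_
    calc ε / K * ‖Φ (x + h) - Φ x‖ ≤ ε / K * (K * ‖h‖) := by gcongr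
      _ = ε * ‖h‖ := by field_simp
  · intro t ht htδ
    have hAt : ‖A t‖ ≤ (‖A‖ + 1) * ‖t‖ := by
      refine (A.le_opNorm t).trans ?_
      gcongr
      linarith
    have hd : dist (Φ x + A t) (Φ x) < δ₂ := by
      rw [dist_eq_norm, add_sub_cancel_left]
      calc ‖A t‖ ≤ (‖A‖ + 1) * ‖t‖ := hAt
        _ ≤ (‖A‖ + 1) * (δ₂ / (2 * (‖A‖ + 1))) := by
            gcongr
            exact htδ.trans (min_le_right _ _)
        _ = δ₂ / 2 := by field_simp
        _ < δ₂ := by linarith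
    obtain ⟨h1, h2⟩ := H2 hd
    refine ⟨Φ.symm (Φ x + A t), symm_mem _ (hA_mem t ht) h2, ?_⟩
    rw [Φ.left_inv hxs, add_sub_cancel_left, hBA] at h1
    rw [← sub_sub]
    refine h1.trans ?_
    calc ε / (‖A‖ + 1) * ‖A t‖ ≤ ε / (‖A‖ + 1) * ((‖A‖ + 1) * ‖t‖) := by gcongr
      _ = ε * ‖t‖ := by field_simp

/-- A best approximation of `x + e` differs from `x` by the tangential part of `e`, up to
first-order small terms. -/
theorem IsSmoothEmbeddedAt.norm_round_sub_le [FiniteDimensional ℝ E] {S : Set E} {x : E}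
    (hS : IsSmoothEmbeddedAt S x) {ε : ℝ} (hε : 0 < ε) :
    ∃ δ > 0, ∀ e p : E, ‖e‖ ≤ δ → IsRound S (x + e) p →
      ‖p - x‖ ≤ ‖(tangentSpaceAt S x).starProjection e‖ + ε * ‖e‖ := by
  -- The normal part of `p - x` costs `2 * η * ‖e‖`. Its tangential part deviates from that of `e`
  -- by at most `√(12 * η) * ‖e‖`. Each may use half of `ε`.
  obtain ⟨η, hη, hη1, hη2, hη3⟩ : ∃ η > 0, η ≤ 1 ∧ 2 * η ≤ ε / 2 ∧ 12 * η ≤ (ε / 2) ^ 2 := by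
    refine ⟨min 1 (min (ε / 4) ((ε / 2) ^ 2 / 12)), by positivity, min_le_left _ _, ?_, ?_⟩
    · have := (min_le_right (1 : ℝ) _).trans (min_le_left (ε / 4) ((ε / 2) ^ 2 / 12))
      linarith
    · have := (min_le_right (1 : ℝ) _).trans (min_le_right (ε / 4) ((ε / 2) ^ 2 / 12))
      linarith
  obtain ⟨δ, hδ, h1, h2⟩ := hS.tangent_approx hη
  refine ⟨δ / 2, by positivity, fun e p he hp => ?_⟩
  set V := tangentSpaceAt S x
  obtain ⟨h, hh⟩ : ∃ h, h = p - x := ⟨_, rfl⟩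
  rw [← hh]
  have hp' : p = x + h := by rw [hh]; abel
  -- The point `x` itself competes with `p`.
  have hhe : ‖h‖ ≤ 2 * ‖e‖ := by
    have h3 := hp.2 x hS.1
    rw [add_sub_cancel_left, hp', add_sub_add_left_eq_sub] at h3
    have h4 := norm_sub_le e (e - h)
    rw [sub_sub_cancel] at h4
    linarith
  obtain ⟨t, htV, ht⟩ := h1 h (by linarith) (hp' ▸ hp.1)
  have hPe : ‖V.starProjection e‖ ≤ ‖e‖ := V.norm_starProjection_apply_le e
  obtain ⟨y, hyS, hy⟩ := h2 _ (V.starProjection_apply_mem e) (by linarith)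
  have hort : ‖h - V.starProjection h‖ ≤ 2 * η * ‖e‖ := by
    have h5 : h - V.starProjection h = (h - t) - V.starProjection (h - t) := by
      rw [map_sub, V.starProjection_eq_self_iff.2 htV]; abel
    have h6 : ‖(h - t) - V.starProjection (h - t)‖ ≤ ‖h - t‖ := by
      have h7 := V.norm_sq_eq_add_norm_sq_starProjection (h - t)
      rw [V.starProjection_orthogonal_val] at h7
      exact le_of_sq_le_sq (by nlinarith [sq_nonneg ‖V.starProjection (h - t)‖]) (norm_nonneg _)
    rw [h5]
    refine h6.trans (ht.trans ?_)
    nlinarith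
  -- The competitor is the point `y` of `S` close to `x` plus the tangential part of `e`.
  have hbest : ‖e - h‖ ≤ ‖e - V.starProjection e‖ + η * ‖e‖ := by
    have h3 := hp.2 y hyS
    have h4 : x + e - p = e - h := by rw [hh]; abel
    have h5 : x + e - y = (e - V.starProjection e) - (y - (x + V.starProjection e)) := by abel
    rw [h4, h5] at h3
    refine h3.trans ((norm_sub_le _ _).trans ?_)
    have : η * ‖V.starProjection e‖ ≤ η * ‖e‖ := by gcongr
    linarith
  have hpyth : ‖e - h‖ ^ 2 = ‖V.starProjection e - V.starProjection h‖ ^ 2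
      + ‖(e - V.starProjection e) - (h - V.starProjection h)‖ ^ 2 := by
    have h7 := V.norm_sq_eq_add_norm_sq_starProjection (e - h)
    rw [V.starProjection_orthogonal_val, map_sub] at h7
    rw [h7]
    congr 3
    abel
  have hlow : ‖e - V.starProjection e‖ - 2 * η * ‖e‖
      ≤ ‖(e - V.starProjection e) - (h - V.starProjection h)‖ :=
    le_trans (by linarith) (norm_sub_norm_le _ _)
  have hue : ‖e - V.starProjection e‖ ≤ ‖e‖ := by
    have h7 := V.norm_sq_eq_add_norm_sq_starProjection e
    rw [V.starProjection_orthogonal_val] at h7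
    exact le_of_sq_le_sq (by nlinarith [sq_nonneg ‖V.starProjection e‖]) (norm_nonneg _)
  -- By Pythagoras the square of the left side is `c ^ 2 - b ^ 2 = (c - b) * (c + b)`, with `c = ‖e
  -- - h‖` and `b` the norm of its normal part. If `b ≤ c`, the factors are at most `3 * η * ‖e‖`
  -- and `4 * ‖e‖`.
  have htan : ‖V.starProjection e - V.starProjection h‖ ≤ ε / 2 * ‖e‖ := by
    refine le_of_sq_le_sq ?_ (by positivity)
    generalize ‖V.starProjection e - V.starProjection h‖ = α at *
    generalize ‖(e - V.starProjection e) - (h - V.starProjection h)‖ = b at *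
    have hb0 : 0 ≤ ‖e - h‖ := norm_nonneg _
    have he0 : 0 ≤ ‖e‖ := norm_nonneg _
    generalize ‖e - V.starProjection e‖ = u at *
    generalize ‖e - h‖ = c at *
    generalize ‖e‖ = z at *
    have hηz : η * z ≤ z := by nlinarith
    have hcz : c ≤ 2 * z := by linarith
    have hcb : c - b ≤ 3 * (η * z) := by linarith
    have key : α ^ 2 ≤ 12 * η * z ^ 2 := by
      have e1 : α ^ 2 = (c - b) * (c + b) := by linarith
      rcases le_total c b with hle | hle
      · have : 0 ≤ 12 * η * z ^ 2 := by positivity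
        nlinarith
      · rcases le_total 0 (c + b) with h0 | h0
        · calc α ^ 2 = (c - b) * (c + b) := e1
            _ ≤ (3 * (η * z)) * (4 * z) := by
                apply mul_le_mul hcb (by linarith) h0 (by positivity)
            _ = _ := by ring
        · have : 0 ≤ 12 * η * z ^ 2 := by positivity
          nlinarith
    calc α ^ 2 ≤ 12 * η * z ^ 2 := key
      _ ≤ (ε / 2) ^ 2 * z ^ 2 := by gcongr
      _ = _ := by ring
  have hsplit : h = V.starProjection e - (V.starProjection e - V.starProjection h)
      + (h - V.starProjection h) := by abel
  calc ‖h‖ = ‖V.starProjection e - (V.starProjection e - V.starProjection h)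
      + (h - V.starProjection h)‖ := by rw [← hsplit]
    _ ≤ ‖V.starProjection e‖ + ‖V.starProjection e - V.starProjection h‖
      + ‖h - V.starProjection h‖ := (norm_add_le _ _).trans (by gcongr; exact norm_sub_le _ _)
    _ ≤ ‖V.starProjection e‖ + ε * ‖e‖ := by
      have : 2 * η * ‖e‖ ≤ ε / 2 * ‖e‖ := by gcongr
      linarith

/-- The rate `(1 + max 0 (cos θ)) / 2` of contraction under the angle condition. -/
noncomputable def rate (θ : ℝ) : ℝ := (1 + max 0 (Real.cos (min θ Real.pi))) / 2

theorem rate_pos (θ : ℝ) : 0 < rate θ := by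
  have := le_max_left 0 (Real.cos (min θ Real.pi))
  unfold rate; linarith

theorem rate_lt_one {θ : ℝ} (hθ : 0 < θ) : rate θ < 1 := by
  have := max_zero_cos_min_lt_one hθ
  unfold rate; linarith

/-- The first-order error may take half of the gap between the cosine bound and `1`; this gives
`rate θ`. -/
theorem IsSmoothEmbeddedAt.round_contracts [FiniteDimensional ℝ E] {S : Set E} {x : E}
    (hS : IsSmoothEmbeddedAt S x) {θ : ℝ} (hθ : 0 < θ) :
    ∃ δ > 0, ∀ e p : E, ‖e‖ ≤ δ → θ < angleTo e (tangentSpaceAt S x) → IsRound S (x + e) p →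
      ‖p - x‖ ≤ rate θ * ‖e‖ := by
  have h1 := max_zero_cos_min_lt_one hθ
  obtain ⟨δ, hδ, h⟩ := hS.norm_round_sub_le
    (ε := (1 - max 0 (Real.cos (min θ Real.pi))) / 2) (by linarith)
  refine ⟨δ, hδ, fun e p he ha hp => (h e p he hp).trans ?_⟩
  have := norm_starProjection_le_of_lt_angleTo hθ ha
  unfold rate
  linarith

end Geometry

end MultiRes
namespace MultiRes

/-! ### Norms of block extension and block averaging. -/

section Blocks

variable {b d k m : ℕ}

theorem ext_sub (h : k ≤ m) (X Y : Tensor b d k) : ext h (X - Y) = ext h X - ext h Y := rfl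

theorem ave_add (h : k ≤ m) (X Y : Tensor b d m) : ave h (X + Y) = ave h X + ave h Y := by
  ext i
  simp [ave, Finset.sum_add_distrib, mul_add]

/-- Fine indices are pairs of a coarse index and a position in the block. -/
def blockEquiv (b d : ℕ) {k m : ℕ} (h : k ≤ m) :
    (Fin d → Fin (b ^ k)) × (Fin d → Fin (b ^ (m - k))) ≃ (Fin d → Fin (b ^ m)) where
  toFun p a := ⟨(p.1 a : ℕ) * b ^ (m - k) + p.2 a, fine_lt h (p.1 a) (p.2 a)⟩
  invFun i := ⟨fun a => ⟨(i a : ℕ) / b ^ (m - k), coarse_lt h (i a)⟩,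
    fun a => ⟨(i a : ℕ) % b ^ (m - k), Nat.mod_lt _ (by
      -- An empty block forces `b ^ m = 0`, which leaves no index `i a`.
      rcases Nat.eq_zero_or_pos (b ^ (m - k)) with h0 | h0
      · have := (i a).isLt
        have e : b ^ m = b ^ k * b ^ (m - k) := by rw [← pow_add, Nat.add_sub_cancel' h]
        simp [e, h0] at this
      · exact h0)⟩⟩
  left_inv p := by
    have key : ∀ a, (((p.1 a : ℕ) * b ^ (m - k) + p.2 a) / b ^ (m - k) = p.1 a) ∧
        (((p.1 a : ℕ) * b ^ (m - k) + p.2 a) % b ^ (m - k) = p.2 a) := by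
      intro a
      have h2 := (p.2 a).isLt
      have h0 : 0 < b ^ (m - k) := by omega
      constructor
      · rw [Nat.add_comm, Nat.add_mul_div_right _ _ h0, Nat.div_eq_of_lt h2, zero_add]
      · rw [Nat.add_comm, Nat.add_mul_mod_self_right, Nat.mod_eq_of_lt h2]
    ext a
    · exact (key a).1
    · exact (key a).2
  right_inv i := by
    ext a
    exact Nat.div_add_mod' _ _

theorem ext_blockEquiv (h : k ≤ m) (X : Tensor b d k)
    (p : (Fin d → Fin (b ^ k)) × (Fin d → Fin (b ^ (m - k)))) :
    ext h X (blockEquiv b d h p) = X p.1 := by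
  have := congrArg Prod.fst ((blockEquiv b d h).left_inv p)
  exact congrArg X this

theorem card_block :
    (Fintype.card (Fin d → Fin (b ^ (m - k))) : ℝ) = (b : ℝ) ^ ((m - k) * d) := by
  simp [pow_mul]

theorem norm_ext_sq (h : k ≤ m) (X : Tensor b d k) :
    ‖ext h X‖ ^ 2 = (b : ℝ) ^ ((m - k) * d) * ‖X‖ ^ 2 := by
  rw [EuclideanSpace.norm_sq_eq, EuclideanSpace.norm_sq_eq, ← (blockEquiv b d h).sum_comp,
    Fintype.sum_prod_type]
  simp_rw [ext_blockEquiv]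
  rw [Finset.mul_sum]
  refine Finset.sum_congr rfl fun i _ => ?_
  rw [Finset.sum_const, nsmul_eq_mul, Finset.card_univ, card_block]

theorem norm_ext (h : k ≤ m) (X : Tensor b d k) :
    ‖ext h X‖ = √((b : ℝ) ^ ((m - k) * d)) * ‖X‖ := by
  rw [← Real.sqrt_sq (norm_nonneg (ext h X)), norm_ext_sq, Real.sqrt_mul (by positivity),
    Real.sqrt_sq (norm_nonneg X)]

theorem one_le_block (hb : 2 ≤ b) (n : ℕ) : (1 : ℝ) ≤ (b : ℝ) ^ n :=
  one_le_pow₀ (by exact_mod_cast (by omega : 1 ≤ b))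

theorem one_le_sqrt_block (hb : 2 ≤ b) (n : ℕ) : (1 : ℝ) ≤ √((b : ℝ) ^ n) :=
  Real.one_le_sqrt.2 (one_le_block hb n)

theorem norm_le_norm_ext (hb : 2 ≤ b) (h : k ≤ m) (X : Tensor b d k) : ‖X‖ ≤ ‖ext h X‖ := by
  rw [norm_ext]
  exact le_mul_of_one_le_left (norm_nonneg X) (one_le_sqrt_block hb _)

theorem ave_ext (hb : 2 ≤ b) (h : k ≤ m) (X : Tensor b d k) : ave h (ext h X) = X := by
  ext i
  have h1 : (0 : ℝ) < (b : ℝ) ^ ((m - k) * d) := one_pos.trans_le (one_le_block hb _)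
  have h2 : ave h (ext h X) i = (1 / (b : ℝ) ^ ((m - k) * d)) *
      ∑ j : Fin d → Fin (b ^ (m - k)), ext h X (blockEquiv b d h (i, j)) := rfl
  rw [h2]
  simp_rw [ext_blockEquiv]
  rw [Finset.sum_const, nsmul_eq_mul, Finset.card_univ, card_block]
  field_simp

/-- Cauchy–Schwarz on each block. Measuring coarse errors after extension to the finest grid thus
loses no constant, so the contraction factor survives averaging. -/
theorem norm_ext_ave_le (hb : 2 ≤ b) (h : k ≤ m) (Y : Tensor b d m) :
    ‖ext h (ave h Y)‖ ≤ ‖Y‖ := by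
  refine le_of_sq_le_sq ?_ (norm_nonneg _)
  have h1 : (0 : ℝ) < (b : ℝ) ^ ((m - k) * d) := one_pos.trans_le (one_le_block hb _)
  rw [norm_ext_sq, EuclideanSpace.norm_sq_eq, EuclideanSpace.norm_sq_eq,
    ← (blockEquiv b d h).sum_comp, Fintype.sum_prod_type, Finset.mul_sum]
  refine Finset.sum_le_sum fun i _ => ?_
  have h2 : ave h Y i = (1 / (b : ℝ) ^ ((m - k) * d)) *
      ∑ j : Fin d → Fin (b ^ (m - k)), Y (blockEquiv b d h (i, j)) := rfl
  have h3 := sq_sum_le_card_mul_sum_sq (s := Finset.univ)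
    (f := fun j : Fin d → Fin (b ^ (m - k)) => Y (blockEquiv b d h (i, j)))
  rw [Finset.card_univ, card_block] at h3
  rw [h2]
  simp only [Real.norm_eq_abs, sq_abs]
  rw [mul_pow]
  calc (b : ℝ) ^ ((m - k) * d) * ((1 / (b : ℝ) ^ ((m - k) * d)) ^ 2
        * (∑ j, Y (blockEquiv b d h (i, j))) ^ 2)
      = (1 / (b : ℝ) ^ ((m - k) * d)) * (∑ j, Y (blockEquiv b d h (i, j))) ^ 2 := by
        field_simp
    _ ≤ (1 / (b : ℝ) ^ ((m - k) * d)) *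
        ((b : ℝ) ^ ((m - k) * d) * ∑ j, Y (blockEquiv b d h (i, j)) ^ 2) := by gcongr
    _ = ∑ j, Y (blockEquiv b d h (i, j)) ^ 2 := by field_simp

end Blocks

/-! ### Splitting the sum over scales. -/

section Sums

variable {b d L : ℕ}

theorem total_eq (X : Scales b d L) (k : Fin (L + 1)) :
    total X = coarser X k + ext (Fin.is_le k) (X k) + finer X k := by
  unfold total coarser finer
  have h : (Finset.univ : Finset (Fin (L + 1))) = insert k (Finset.Iio k) ∪ Finset.Ioi k := by
    ext l
    simpa using le_or_gt l k
  rw [h, Finset.sum_union, Finset.sum_insert (by simp), add_comm (ext _ _)]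
  rw [Finset.disjoint_left]
  intro l hl hl'
  simp only [Finset.mem_insert, Finset.mem_Iio, Finset.mem_Ioi] at hl hl'
  omega

theorem coarser_sub (X Y : Scales b d L) (k : Fin (L + 1)) :
    coarser (fun l => X l - Y l) k = coarser X k - coarser Y k := by
  simp [coarser, ext_sub]

theorem finer_sub (X Y : Scales b d L) (k : Fin (L + 1)) :
    finer (fun l => X l - Y l) k = finer X k - finer Y k := by
  simp [finer, ext_sub]

end Sums

end MultiRes
-- Error recursion on one scale and propagation through the scales.
namespace MultiRes

/-- With `c = g / (1 - q)` one has `q * (g + c) ≤ c`, so the bound `q ^ n * a + c` is preserved. As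
`g ≤ c`, the quantities required to be at most `δ` never exceed `a + 2 * c`. An iteration makes two
contractions, of which only one factor `q` is kept, so that `x` and `s` obey the same bound. -/
theorem alternating_bound {q a g δ : ℝ} (hq : 0 < q) (hq1 : q < 1) (hg : 0 ≤ g) {M : ℕ}
    {x s : ℕ → ℝ} (hx0 : x 0 ≤ a) (hs0 : s 0 ≤ a) (ha : 0 ≤ a)
    (hδ : a + 2 * (g / (1 - q)) ≤ δ)
    (hx : ∀ n < M, g + s n ≤ δ → x (n + 1) ≤ q * (g + s n))
    (hs : ∀ n < M, g + x (n + 1) ≤ δ → s (n + 1) ≤ q * (g + x (n + 1))) :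
    ∀ n ≤ M, x n ≤ q ^ n * a + g / (1 - q) ∧ s n ≤ q ^ n * a + g / (1 - q) := by
  have h1 : 0 < 1 - q := by linarith
  obtain ⟨c, hc⟩ : ∃ c, c = g / (1 - q) := ⟨_, rfl⟩
  have hcg : c * (1 - q) = g := by rw [hc]; field_simp
  have hc0 : 0 ≤ c := by rw [hc]; positivity
  rw [← hc] at hδ ⊢
  have hgc : g ≤ c := by nlinarith
  have small : ∀ n, q ^ n * a ≤ a := fun n =>
    mul_le_of_le_one_left ha (pow_le_one₀ hq.le hq1.le)
  have step : ∀ n y, y ≤ q ^ n * a + c → q * (g + y) ≤ q ^ (n + 1) * a + c := by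
    intro n y hy
    calc q * (g + y) ≤ q * (g + (q ^ n * a + c)) := by gcongr
      _ = q ^ (n + 1) * a + q * (g + c) := by ring
      _ ≤ q ^ (n + 1) * a + c := by nlinarith
  have weaken : ∀ n y, y ≤ q ^ (n + 1) * a + c → q * (g + y) ≤ q ^ (n + 1) * a + c := by
    intro n y hy
    have h2 := step (n + 1) y hy
    have h3 : q ^ (n + 1 + 1) * a ≤ q ^ (n + 1) * a := by
      gcongr ?_ * a
      exact pow_le_pow_of_le_one hq.le hq1.le (by omega)
    linarith
  intro n
  induction n with
  | zero => intro _; simp only [pow_zero, one_mul]; constructor <;> linarith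
  | succ n ih =>
    intro hn
    obtain ⟨-, ihs⟩ := ih (by omega)
    have e1 : x (n + 1) ≤ q ^ (n + 1) * a + c :=
      (hx n (by omega) (by linarith [small n])).trans (step n _ ihs)
    exact ⟨e1, (hs n (by omega) (by linarith [small (n + 1)])).trans (weaken n _ e1)⟩

variable {b d L : ℕ}

theorem norm_coarser_le (X : Scales b d L) (k : Fin (L + 1)) :
    ‖coarser X k‖ ≤ ∑ l ∈ Finset.Iio k, ‖ext (Fin.is_le l) (X l)‖ :=
  norm_sum_le _ _

/-- Constants with `growth β k = β * (1 + ∑ l < k, growth β l)`. -/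
noncomputable def growth (β : ℝ) (k : ℕ) : ℝ := β * (1 + β) ^ k

theorem sum_growth (β : ℝ) (k : Fin (L + 1)) :
    ∑ l ∈ Finset.Iio k, growth β l = (1 + β) ^ (k : ℕ) - 1 := by
  have h : ∑ l ∈ Finset.Iio k, growth β l = ∑ l ∈ Finset.Iio (k : ℕ), growth β l := by
    rw [← Fin.map_valEmbedding_Iio, Finset.sum_map]
    rfl
  rw [h, Nat.Iio_eq_range]
  unfold growth
  rw [← Finset.mul_sum, mul_comm, ← mul_geom_sum]
  ring

theorem exists_uniform_contraction {P : Type*} [AddCommMonoid P] [PartialOrder P]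
    {F : TensorFormat b d P} {r : Fin (L + 1) → P} {T : Scales b d L}
    (hsmooth : ClosedSmooth F r T) {θ : ℝ} (hθ : 0 < θ) :
    ∃ δ > 0, ∀ k : Fin (L + 1),
      (∀ e p, ‖e‖ ≤ δ → θ < angleTo e (tangentSpaceAt (F.le k (r k)) (T k)) →
        IsRound (F.le k (r k)) (T k + e) p → ‖p - T k‖ ≤ rate θ * ‖e‖) ∧
      ∀ e p, ‖e‖ ≤ δ →
        θ < angleTo e (tangentSpaceAt (F.le L (finerRank r k)) (finer T k)) →
        IsRound (F.le L (finerRank r k)) (finer T k + e) p → ‖p - finer T k‖ ≤ rate θ * ‖e‖ := by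
  choose δ₁ hδ₁ h₁ using fun k => (hsmooth k).1.2.round_contracts hθ
  choose δ₂ hδ₂ h₂ using fun k => (hsmooth k).2.2.round_contracts hθ
  obtain ⟨k₁, hk₁⟩ := Finite.exists_min δ₁
  obtain ⟨k₂, hk₂⟩ := Finite.exists_min δ₂
  refine ⟨min (δ₁ k₁) (δ₂ k₂), lt_min (hδ₁ _) (hδ₂ _), fun k => ⟨fun e p he => ?_, fun e p he => ?_⟩⟩
  · exact h₁ k e p (he.trans ((min_le_left _ _).trans (hk₁ k)))
  · exact h₂ k e p (he.trans ((min_le_right _ _).trans (hk₂ k)))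

/-- The errors of the alternating iteration on one scale. -/
theorem scale_bound {P : Type*} [AddCommMonoid P] [PartialOrder P] (hb : 2 ≤ b)
    {F : TensorFormat b d P} {r : Fin (L + 1) → P} {T : Scales b d L} {θ δ : ℝ} (hθ : 0 < θ)
    {A : Tensor b d L} {M : ℕ} {X : (k : Fin (L + 1)) → ℕ → Tensor b d k}
    {S : Fin (L + 1) → ℕ → Tensor b d L} (hrun : IsRun F r A M X S)
    (hang : AngleSeparated F r A T θ M X S) (k : Fin (L + 1))
    (hT : ∀ e p, ‖e‖ ≤ δ → θ < angleTo e (tangentSpaceAt (F.le k (r k)) (T k)) →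
        IsRound (F.le k (r k)) (T k + e) p → ‖p - T k‖ ≤ rate θ * ‖e‖)
    (hU : ∀ e p, ‖e‖ ≤ δ →
        θ < angleTo e (tangentSpaceAt (F.le L (finerRank r k)) (finer T k)) →
        IsRound (F.le L (finerRank r k)) (finer T k + e) p → ‖p - finer T k‖ ≤ rate θ * ‖e‖)
    {a g : ℝ} (hg : ‖A - total T‖ +
      ∑ l ∈ Finset.Iio k, ‖ext (Fin.is_le l) (X l M - T l)‖ ≤ g)
    (hX0 : ‖ext (Fin.is_le k) (X k 0 - T k)‖ ≤ a) (hS0 : ‖S k 0 - finer T k‖ ≤ a)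
    (hδ : a + 2 * (g / (1 - rate θ)) ≤ δ) :
    ∀ n ≤ M, ‖ext (Fin.is_le k) (X k n - T k)‖ ≤ rate θ ^ n * a + g / (1 - rate θ) := by
  have hG : ‖A - total T‖ + ‖coarser (fun l => T l - X l M) k‖ ≤ g := by
    refine le_trans ?_ hg
    gcongr
    refine (norm_coarser_le _ _).trans (le_of_eq (Finset.sum_congr rfl fun l _ => ?_))
    rw [ext_sub, ext_sub, norm_sub_rev]
  have hg0 : 0 ≤ g := le_trans (by positivity) hG
  have htot := total_eq T k
  have hco := coarser_sub T (fun l => X l M) k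
  suffices h : ∀ n ≤ M,
      ‖ext (Fin.is_le k) (X k n - T k)‖ ≤ rate θ ^ n * a + g / (1 - rate θ) ∧
      ‖S k n - finer T k‖ ≤ rate θ ^ n * a + g / (1 - rate θ) from fun n hn => (h n hn).1
  refine alternating_bound (rate_pos θ) (rate_lt_one hθ) hg0 hX0 hS0
    ((norm_nonneg _).trans hS0) hδ ?_ ?_
  · intro n hn hsmall
    have hE : ‖ext (Fin.is_le k) (errorE A T M X S k n)‖ ≤ g + ‖S k n - finer T k‖ := by
      refine (norm_ext_ave_le hb _ _).trans ?_
      have e : A - total T - S k n + finer T k + coarser (fun l => T l - X l M) k =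
          (A - total T) + coarser (fun l => T l - X l M) k - (S k n - finer T k) := by abel
      rw [e]
      refine (norm_sub_le _ _).trans ?_
      gcongr
      exact (norm_add_le _ _).trans hG
    have hround := (hrun k n hn).1
    -- Averaging this identity exhibits the rounded tensor as `T k` plus `errorE`.
    have e : A - coarser (fun l => X l M) k - S k n = ext (Fin.is_le k) (T k) +
        (A - total T - S k n + finer T k + coarser (fun l => T l - X l M) k) := by
      rw [hco, htot]; abel
    rw [e, ave_add, ave_ext hb] at hround
    have hcontr := hT _ _ ((norm_le_norm_ext hb _ _).trans (hE.trans hsmall)) (hang k n hn).1 hround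
    -- Extension scales every norm by the same factor, so the contraction on the coarse grid carries
    -- over to the finest grid.
    rw [norm_ext] at hE ⊢
    calc √((b : ℝ) ^ ((L - (k : ℕ)) * d)) * ‖X k (n + 1) - T k‖
        ≤ √((b : ℝ) ^ ((L - (k : ℕ)) * d)) * (rate θ * ‖errorE A T M X S k n‖) := by gcongr
      _ = rate θ * (√((b : ℝ) ^ ((L - (k : ℕ)) * d)) * ‖errorE A T M X S k n‖) := by ring
      _ ≤ _ := mul_le_mul_of_nonneg_left hE (rate_pos θ).le
  · intro n hn hsmall
    have hD : ‖errorD A T M X k n‖ ≤ g + ‖ext (Fin.is_le k) (X k (n + 1) - T k)‖ := by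
      have e : errorD A T M X k n = (A - total T) + coarser (fun l => T l - X l M) k
          - ext (Fin.is_le k) (X k (n + 1) - T k) := by
        rw [errorD, ext_sub, ext_sub]; abel
      rw [e]
      refine (norm_sub_le _ _).trans ?_
      gcongr
      exact (norm_add_le _ _).trans hG
    have hround := (hrun k n hn).2
    have e : A - coarser (fun l => X l M) k - ext (Fin.is_le k) (X k (n + 1)) =
        finer T k + errorD A T M X k n := by
      rw [errorD, hco, htot, ext_sub]; abel
    rw [e] at hround
    exact (hU _ _ (hD.trans hsmall) (hang k n hn).2 hround).trans
      (mul_le_mul_of_nonneg_left hD (rate_pos θ).le)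

/-- All iterates satisfy one error bound, with a geometrically decreasing part and a part
proportional to the residual. -/
theorem exists_iterate_bound {P : Type*} [AddCommMonoid P] [PartialOrder P] (hb : 2 ≤ b)
    {F : TensorFormat b d P} {r : Fin (L + 1) → P} {T : Scales b d L}
    (hsmooth : ClosedSmooth F r T) {θ : ℝ} (hθ : 0 < θ) :
    ∃ C > 0, ∃ K ≥ 0, ∃ B ≥ 0, ∀ (A : Tensor b d L) (T₀ : Scales b d L)
      (X : ℕ → (k : Fin (L + 1)) → ℕ → Tensor b d k) (S : ℕ → Fin (L + 1) → ℕ → Tensor b d L),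
      (∀ M, IsRun F r A M (X M) (S M)) → (∀ M k, X M k 0 = T₀ k) →
      (∀ M k, ‖S M k 0 - finer T₀ k‖ ≤ C) →
      (∀ M, AngleSeparated F r A T θ M (X M) (S M)) → (∀ k, ‖T k - T₀ k‖ ≤ C) →
      ‖A - total T‖ ≤ C →
      ∀ M, ∀ n ≤ M, ∀ k, ‖X M k n - T k‖ ≤ K * rate θ ^ n + B * ‖A - total T‖ := by
  obtain ⟨δ, hδ, hloc⟩ := exists_uniform_contraction hsmooth hθ
  have hq0 := rate_pos θ
  have hq1 : 0 < 1 - rate θ := by linarith [rate_lt_one hθ]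
  obtain ⟨β, hβ⟩ : ∃ β, β = 1 / (1 - rate θ) := ⟨_, rfl⟩
  have hβ1 : 1 ≤ β := by
    rw [hβ, le_div_iff₀ hq1]; linarith
  let c : Fin (L + 1) → ℝ := fun k => √((b : ℝ) ^ ((L - (k : ℕ)) * d))
  -- `s * C` dominates all initial errors on the finest grid: the sum accounts for extending the
  -- errors of the `T₀ k`, the `1` for the freedom in `S M k 0`.
  obtain ⟨s, hs⟩ : ∃ s, s = 1 + ∑ k, c k := ⟨_, rfl⟩
  have hc0 : ∀ k, 0 ≤ c k := fun k => Real.sqrt_nonneg _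
  have hs1 : 1 ≤ s := by
    rw [hs]; linarith [Finset.sum_nonneg fun k (_ : k ∈ Finset.univ) => hc0 k]
  have hD0 : ∀ k, 0 < growth β k := fun k => by unfold growth; positivity
  have hD1 : ∀ k, 1 ≤ growth β k := fun k =>
    one_le_mul_of_one_le_of_one_le hβ1 (one_le_pow₀ (by linarith))
  have hDL : ∀ k : Fin (L + 1), growth β k ≤ growth β L := fun k => by
    unfold growth
    gcongr
    · linarith
    · exact Fin.is_le k
  have hDL0 := hD0 L
  -- The condition of `scale_bound` is `a + 2 * (g / (1 - rate θ)) ≤ δ`; both `a` and `g / (1 - rate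
  -- θ)` are at most `growth β L * (s * C + C)`, whence the `3`.
  obtain ⟨C, hC⟩ : ∃ C, C = δ / (3 * growth β L * (s + 1)) := ⟨_, rfl⟩
  have hC0 : 0 < C := by rw [hC]; positivity
  have hCδ : 3 * growth β L * (s * C + C) = δ := by rw [hC]; field_simp
  refine ⟨C, hC0, growth β L * (s * C), by positivity, growth β L, hDL0.le, ?_⟩
  intro A T₀ X S hrun hX hS hang hT₀ hA M
  have hext0 : ∀ k : Fin (L + 1), ‖ext (Fin.is_le k) (T₀ k - T k)‖ ≤ c k * C := fun k => by
    rw [norm_ext, norm_sub_rev]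
    exact mul_le_mul_of_nonneg_left (hT₀ k) (hc0 k)
  have hX0 : ∀ k : Fin (L + 1), ‖ext (Fin.is_le k) (X M k 0 - T k)‖ ≤ s * C := fun k => by
    rw [hX]
    refine (hext0 k).trans (mul_le_mul_of_nonneg_right ?_ hC0.le)
    rw [hs]
    linarith [Finset.single_le_sum (fun k _ => hc0 k) (Finset.mem_univ k)]
  have hS0 : ∀ k : Fin (L + 1), ‖S M k 0 - finer T k‖ ≤ s * C := fun k => by
    have h1 : ‖finer T₀ k - finer T k‖ ≤ (∑ k, c k) * C := by
      rw [← finer_sub, Finset.sum_mul]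
      refine (norm_sum_le _ _).trans ((Finset.sum_le_sum fun l _ => hext0 l).trans ?_)
      exact Finset.sum_le_sum_of_subset_of_nonneg (Finset.subset_univ _)
        fun l _ _ => mul_nonneg (hc0 l) hC0.le
    calc ‖S M k 0 - finer T k‖ ≤ ‖S M k 0 - finer T₀ k‖ + ‖finer T₀ k - finer T k‖ :=
          norm_sub_le_norm_sub_add_norm_sub _ _ _
      _ ≤ C + (∑ k, c k) * C := add_le_add (hS M k) h1
      _ = s * C := by rw [hs]; ring
  have hmain : ∀ m, ∀ k : Fin (L + 1), (k : ℕ) = m → ∀ n ≤ M,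
      ‖ext (Fin.is_le k) (X M k n - T k)‖ ≤
        growth β k * (rate θ ^ n * (s * C) + ‖A - total T‖) := by
    intro m
    induction m using Nat.strong_induction_on with
    | _ m ih =>
    intro k hk
    obtain ⟨ρ, hρ⟩ : ∃ ρ, ρ = ‖A - total T‖ := ⟨_, rfl⟩
    have hρ0 : 0 ≤ ρ := hρ ▸ norm_nonneg _
    rw [← hρ] at ih hA ⊢
    have hpow : rate θ ^ M ≤ 1 := pow_le_one₀ hq0.le (by linarith)
    have hg : ρ + ∑ l ∈ Finset.Iio k, ‖ext (Fin.is_le l) (X M l M - T l)‖ ≤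
        ρ + ((1 + β) ^ (k : ℕ) - 1) * (rate θ ^ M * (s * C) + ρ) := by
      rw [← sum_growth, Finset.sum_mul]
      gcongr with l hl
      have : l < k := by simpa using hl
      exact ih l (by omega) l rfl M le_rfl
    have hβk : growth β k = β * (1 + β) ^ (k : ℕ) := rfl
    have hkpow : 1 ≤ (1 + β) ^ (k : ℕ) := one_le_pow₀ (by linarith)
    have hgβ : ∀ g, g / (1 - rate θ) = β * g := fun g => by rw [hβ]; ring
    have hsC : 0 ≤ s * C := by positivity
    have hg' := hg
    nth_rewrite 1 [hρ] at hg'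
    have hbound := scale_bound hb hθ (hrun M) (hang M) k (hloc k).1 (hloc k).2 hg'
      (hX0 k) (hS0 k) ?_
    · intro n hn
      refine (hbound n hn).trans ?_
      rw [hgβ]
      -- Coarser scales enter only through their final iterates, whose geometric part `rate θ ^ M`
      -- is absorbed by that of step `n ≤ M`. Hence the rate does not deteriorate from scale to
      -- scale.
      have h1 : rate θ ^ M ≤ rate θ ^ n := pow_le_pow_of_le_one hq0.le (by linarith) hn
      have h2 : rate θ ^ M * (s * C) ≤ rate θ ^ n * (s * C) := by gcongr
      calc _ ≤ rate θ ^ n * (s * C) +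
            β * (ρ + ((1 + β) ^ (k : ℕ) - 1) * (rate θ ^ n * (s * C) + ρ)) := by
              gcongr
        _ ≤ β * (rate θ ^ n * (s * C)) +
            β * (ρ + ((1 + β) ^ (k : ℕ) - 1) * (rate θ ^ n * (s * C) + ρ)) := by
              gcongr ?_ + _
              exact le_mul_of_one_le_left (by positivity) hβ1
        _ = _ := by rw [hβk]; ring
    · rw [hgβ, ← hCδ]
      have h2 : rate θ ^ M * (s * C) ≤ s * C := mul_le_of_le_one_left hsC hpow
      calc _ ≤ s * C + 2 * (β * (ρ + ((1 + β) ^ (k : ℕ) - 1) * (s * C + ρ))) := by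
            gcongr
        _ ≤ s * C + 2 * (β * ((s * C + ρ) + ((1 + β) ^ (k : ℕ) - 1) * (s * C + ρ))) := by
            gcongr
            linarith
        _ = s * C + 2 * (growth β k * (s * C + ρ)) := by rw [hβk]; ring
        _ ≤ growth β L * (s * C + C) + 2 * (growth β L * (s * C + C)) := by
            refine add_le_add ?_ ?_
            · nlinarith [hD1 L]
            · have := hDL k
              gcongr
        _ = _ := by ring
  intro n hn k
  refine (norm_le_norm_ext hb _ _).trans ((hmain k k rfl n hn).trans ?_)
  calc _ ≤ growth β L * (rate θ ^ n * (s * C) + ‖A - total T‖) := by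
        have := hDL k
        gcongr
    _ = _ := by ring

end MultiRes

/-! ### Convergence of the algorithm. -/

theorem mainTheorem4 {P : Type*} [AddCommMonoid P] [PartialOrder P] (b d L : ℕ) (hb : 2 ≤ b)
    (F : MultiRes.TensorFormat b d P) (r : Fin (L + 1) → P) (T : MultiRes.Scales b d L)
    (hsmooth : MultiRes.ClosedSmooth F r T) (hmin : MultiRes.Minimal F r T)
    (θ : ℝ) (hθ : 0 < θ) :
    ∃ C > 0, ∃ Ck : Fin (L + 1) → ℝ,
      ∀ A : MultiRes.Tensor b d L, MultiRes.IsIsolatedOptimal F r A T →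
      -- the initial guess, and the iterates for every maximum iteration number `M`
      ∀ (T₀ : MultiRes.Scales b d L)
        (X : ℕ → (k : Fin (L + 1)) → ℕ → MultiRes.Tensor b d k)
        (S : ℕ → Fin (L + 1) → ℕ → MultiRes.Tensor b d L),
        (∀ M, MultiRes.IsRun F r A M (X M) (S M)) →
        (∀ M k, X M k 0 = T₀ k) →
        (∀ M k, ‖S M k 0 - MultiRes.finer T₀ k‖ ≤ C) →
        (∀ M, MultiRes.AngleSeparated F r A T θ M (X M) (S M)) →
        (∀ k, ‖T k - T₀ k‖ ≤ C) →
        (A = MultiRes.total T →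
          ∃ K q : ℝ, 0 ≤ q ∧ q < 1 ∧ ∀ M, ∀ n ≤ M, ∀ k, ‖X M k n - T k‖ ≤ K * q ^ n) ∧
        (‖A - MultiRes.total T‖ ≤ C →
          (A ≠ MultiRes.total T →
            ∃ N, ∀ M n, N ≤ n → n ≤ M → ∀ k,
              ‖T k - X M k n‖ ≤ Ck k * ‖A - MultiRes.total T‖) ∧
          ∃ φ : ℕ → ℕ, StrictMono φ ∧ ∃ Y : MultiRes.Scales b d L, ∀ k,
            Tendsto (fun j => X (φ j) k (φ j)) atTop (𝓝 (Y k)) ∧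
            ‖T k - Y k‖ ≤ Ck k * ‖A - MultiRes.total T‖) := by
  obtain ⟨C, hC, K, hK, B, hB, H⟩ := MultiRes.exists_iterate_bound hb hsmooth hθ
  have hq0 := MultiRes.rate_pos θ
  have hq1 := MultiRes.rate_lt_one hθ
  -- The `+ 1` absorbs the geometric term once it has dropped below the nonzero residual.
  refine ⟨C, hC, fun _ => B + 1, ?_⟩
  intro A _ T₀ X S hrun hX hS hang hT₀
  replace H := H A T₀ X S hrun hX hS hang hT₀
  have hlim : Tendsto (fun n => K * MultiRes.rate θ ^ n) atTop (𝓝 0) := by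
    simpa using (tendsto_pow_atTop_nhds_zero_of_lt_one hq0.le hq1).const_mul K
  refine ⟨fun hA => ⟨K, MultiRes.rate θ, hq0.le, hq1, fun M n hn k => ?_⟩, fun hA => ⟨?_, ?_⟩⟩
  · have hz : ‖A - MultiRes.total T‖ = 0 := by rw [hA, sub_self, norm_zero]
    simpa [hz] using H (hz.le.trans hC.le) M n hn k
  · intro hne
    have hpos : 0 < ‖A - MultiRes.total T‖ := norm_pos_iff.2 (sub_ne_zero.2 hne)
    obtain ⟨N, hN⟩ := (hlim.eventually (ge_mem_nhds hpos)).exists_forall_of_atTop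
    refine ⟨N, fun M n hNn hn k => ?_⟩
    rw [norm_sub_rev]
    linarith [H hA M n hn k, hN n hNn]
  -- Compactness is used in the product over all scales, so that one subsequence serves every `k`.
  · have hbdd : ∀ M, (fun k => X M k M) ∈ Metric.closedBall T (K + B * ‖A - MultiRes.total T‖) := by
      intro M
      rw [mem_closedBall_iff_norm, pi_norm_le_iff_of_nonneg (by positivity)]
      intro k
      refine (H hA M M le_rfl k).trans ?_
      gcongr
      exact mul_le_of_le_one_right hK (pow_le_one₀ hq0.le hq1.le)
    obtain ⟨Y, -, φ, hφ, hY⟩ := (isCompact_closedBall T _).tendsto_subseq hbdd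
    refine ⟨φ, hφ, Y, fun k => ?_⟩
    have hYk : Tendsto (fun j => X (φ j) k (φ j)) atTop (𝓝 (Y k)) := (tendsto_pi_nhds.1 hY) k
    refine ⟨hYk, ?_⟩
    have h1 : ‖Y k - T k‖ ≤ 0 + B * ‖A - MultiRes.total T‖ :=
      le_of_tendsto_of_tendsto' (hYk.sub_const (T k)).norm
        ((hlim.comp hφ.tendsto_atTop).add_const _) fun j => H hA (φ j) (φ j) le_rfl k
    rw [norm_sub_rev]
    linarith [norm_nonneg (A - MultiRes.total T)]
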